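/- Let $\ell$ and $k$ be integers with $0 \le \ell < k$ and $k \ge 4$. Then there is a coprime mapping from $A=\{\ell+1,\dots,\ell+k\}$ to $B=\{\ell+k+1,\dots,\ell+2k\}$, that is, a bijection $f : A \to B$ such that $a$ and $f(a)$ are coprime for every $a \in A$. -/

import Mathlib

/-- A coprime mapping from `A` to `B`, where `A` and `B` are sets of integers: a bijection
`f : A → B` such that `a` and `f a` are coprime for every `a ∈ A`. -/
def IsCoprimeMapping {A B : Set ℤ} (f : A → B) : Prop :=
  Function.Bijective f ∧ ∀ a : A, IsCoprime (a : ℤ) (f a : ℤ)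

/-! For `k ≥ 114`, odd entries of `A` are paired with even entries of `B` and conversely. Each half
pairs two progressions of step 2 with `m ≥ 57` terms, where only common odd primes obstruct
coprimality, and Hall's theorem applies.

If Hall's condition fails then, up to exchanging the two sides, there is `D < m / 2` such that more
than `D` terms have at most `D` partners each. A sieve excludes this (`not_siftedCard_le`). For `m <
40000` a term has at most five odd prime factors, hence more than `m / 3` partners, and at least `m
/ 2` if 3 does not divide it; so the bad terms are multiples of 3, of which there are at most `m / 3
+ 1`. For larger `m`, a term `n` has about `m / r` partners, with `r` the product of `p / (p - 1)`
over odd primes `p ∣ n`; since `r` is at most about `7 / 5` on average, bad terms are too few.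

For `k < 114` a kernel computation cuts both intervals into at most three blocks matched by
reflections `a ↦ s - a`; three exceptional pairs get explicit matchings. -/

/-- Two sets of natural numbers admit a bijection pairing coprime numbers. -/
def CoprimeMatchable (A B : Set ℕ) : Prop :=
  ∃ f : ℕ → ℕ, Set.BijOn f A B ∧ ∀ a ∈ A, Nat.Coprime a (f a)

theorem CoprimeMatchable.union {A B A' B' : Set ℕ} (h : CoprimeMatchable A B)
    (h' : CoprimeMatchable A' B') (hA : Disjoint A A') (hB : Disjoint B B') :
    CoprimeMatchable (A ∪ A') (B ∪ B') := by
  classical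
  obtain ⟨f, hf, hfc⟩ := h
  obtain ⟨g, hg, hgc⟩ := h'
  have e1 : Set.EqOn (A.piecewise f g) f A := Set.piecewise_eqOn A f g
  have e2 : Set.EqOn (A.piecewise f g) g A' :=
    (Set.piecewise_eqOn_compl A f g).mono fun x hx hxA => Set.disjoint_left.1 hA hxA hx
  have b1 := hf.congr e1.symm
  have b2 := hg.congr e2.symm
  refine ⟨A.piecewise f g, b1.union b2 ?_, ?_⟩
  · refine (Set.injOn_union hA).2 ⟨b1.injOn, b2.injOn, fun a ha b hb hab => ?_⟩
    exact Set.disjoint_left.1 hB (b1.mapsTo ha) (hab ▸ b2.mapsTo hb)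
  · rintro a (ha | ha)
    · rw [e1 ha]; exact hfc a ha
    · rw [e2 ha]; exact hgc a ha

/-! ### Small `k`: matchings by reflected blocks -/

/-- `reflectCoprime g x s` tests that `x + i` and `s - i` are coprime for `1 ≤ i ≤ g`. -/
def reflectCoprime : ℕ → ℕ → ℕ → Bool
  | 0, _, _ => true
  | g + 1, x, s => (Nat.gcd (x + 1) s).beq 1 && reflectCoprime g (x + 1) (s - 1)

theorem coprime_of_reflectCoprime : ∀ (g x s : ℕ), reflectCoprime g x s = true →
    ∀ i < g, Nat.Coprime (x + 1 + i) (s - i)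
  | 0, _, _, _, _, hi => absurd hi (Nat.not_lt_zero _)
  | g + 1, x, s, h, i, hi => by
    rw [reflectCoprime, Bool.and_eq_true] at h
    rcases i with _ | i
    · exact Nat.eq_of_beq_eq_true h.1
    · have := coprime_of_reflectCoprime g (x + 1) (s - 1) h.2 i (by omega)
      rwa [show x + 1 + 1 + i = x + 1 + (i + 1) by ring, Nat.sub_sub, Nat.add_comm 1 i] at this

/-- A sufficient condition for `reflectCoprime g x s`: either `x + 1 + s` is less than `29 ^ 2` and
coprime to all primes below `29`, or the definition is checked directly. -/
def fastReflectCoprime (g x s : ℕ) : Bool :=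
  ((Nat.gcd (x + 1 + s) 223092870).beq 1 && (x + 1 + s).ble 840) || reflectCoprime g x s

/-- The constant 223092870 is the product of the primes up to 23. Reflections with prime sum `p` are
always coprime, because `gcd (a, p - a) = gcd (a, p)`. -/
theorem prime_of_coprime_of_lt {n : ℕ} (h1 : n ≠ 1) (hn : n < 841)
    (h : Nat.gcd n 223092870 = 1) : n.Prime := by
  by_contra hp
  have hn0 : 0 < n := by
    rcases Nat.eq_zero_or_pos n with rfl | h0
    · norm_num at h
    · exact h0
  have hsq := Nat.minFac_sq_le_self hn0 hp
  have hpr := Nat.minFac_prime h1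
  have hlt : n.minFac < 29 := by nlinarith
  have hdvd : n.minFac ∣ 223092870 := by
    generalize n.minFac = q at hpr hlt
    clear hsq
    interval_cases q <;> first | (exfalso; revert hpr; norm_num; done) | norm_num
  exact hpr.one_lt.ne' (Nat.dvd_one.1 (h ▸ Nat.dvd_gcd n.minFac_dvd hdvd))

theorem coprimeMatchable_of_coprime (g x y : ℕ)
    (h : ∀ a ∈ Set.Ioc x (x + g), Nat.Coprime a (x + y + g + 1 - a)) :
    CoprimeMatchable (Set.Ioc x (x + g)) (Set.Ioc y (y + g)) := by
  refine ⟨fun a => x + y + g + 1 - a, ⟨fun a ha => ?_, fun a ha b hb hab => ?_, fun b hb => ?_⟩, h⟩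
  · simp only [Set.mem_Ioc] at ha ⊢; omega
  · simp only [Set.mem_Ioc] at ha hb hab; omega
  · simp only [Set.mem_Ioc] at hb
    exact ⟨x + y + g + 1 - b, by simp only [Set.mem_Ioc]; omega, by simp only; omega⟩

theorem coprimeMatchable_of_fastReflectCoprime (g x y : ℕ)
    (h : fastReflectCoprime g x (y + g) = true) :
    CoprimeMatchable (Set.Ioc x (x + g)) (Set.Ioc y (y + g)) := by
  apply coprimeMatchable_of_coprime
  intro a ha
  simp only [Set.mem_Ioc] at ha
  rw [fastReflectCoprime, Bool.or_eq_true, Bool.and_eq_true] at h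
  rcases h with ⟨h1, h2⟩ | h
  · have hp := prime_of_coprime_of_lt (n := x + 1 + (y + g)) (by omega)
      (Nat.lt_succ_of_le (Nat.le_of_ble_eq_true h2)) (Nat.eq_of_beq_eq_true h1)
    rw [show x + y + g + 1 = x + 1 + (y + g) by ring]
    rw [Nat.coprime_sub_self_right (by omega)]
    exact (Nat.coprime_of_lt_prime (by omega) (by omega) hp).symm
  · have := coprime_of_reflectCoprime g x (y + g) h (a - x - 1) (by omega)
    rwa [show x + 1 + (a - x - 1) = a by omega,
      show y + g - (a - x - 1) = x + y + g + 1 - a by omega] at this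

/-- Search for a cut of two intervals of length `g` such that the upper blocks are matched by a
reflection, and the lower blocks are handled by `next`. The upper block has length `g - i`, and
`i` runs over the last `fuel` values below `g`. -/
def searchCut (next : ℕ → Bool) (x y g : ℕ) : ℕ → Bool
  | 0 => false
  | fuel + 1 =>
    (fastReflectCoprime (fuel + 1) (x + (g - (fuel + 1))) (y + g) && next (g - (fuel + 1))) ||
      searchCut next x y g fuel

/-- Cut two intervals into at most `depth` blocks which are matched by reflections. -/
def searchBlocks : ℕ → ℕ → ℕ → ℕ → Bool
  | 0, _, _, g => g.beq 0
  | depth + 1, x, y, g => g.beq 0 || searchCut (searchBlocks depth x y) x y g g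

theorem coprimeMatchable_of_searchCut (next : ℕ → Bool) (x y g : ℕ)
    (hn : ∀ i, next i = true → CoprimeMatchable (Set.Ioc x (x + i)) (Set.Ioc y (y + i))) :
    ∀ fuel ≤ g, searchCut next x y g fuel = true →
      CoprimeMatchable (Set.Ioc x (x + g)) (Set.Ioc y (y + g))
  | 0, _, h => absurd h (by simp [searchCut])
  | fuel + 1, hf, h => by
    rw [searchCut, Bool.or_eq_true, Bool.and_eq_true] at h
    rcases h with ⟨h1, h2⟩ | h
    · obtain ⟨i, rfl⟩ := Nat.exists_eq_add_of_le' hf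
      rw [Nat.add_sub_cancel] at h1 h2
      have := (hn i h2).union (coprimeMatchable_of_fastReflectCoprime (fuel + 1) (x + i) (y + i)
        (by rwa [Nat.add_assoc y i])) (Set.Ioc_disjoint_Ioc_of_le le_rfl)
        (Set.Ioc_disjoint_Ioc_of_le le_rfl)
      rwa [Set.Ioc_union_Ioc_eq_Ioc (by omega) (by omega),
        Set.Ioc_union_Ioc_eq_Ioc (by omega) (by omega), Nat.add_assoc x, Nat.add_assoc y] at this
    · exact coprimeMatchable_of_searchCut next x y g hn fuel (by omega) h

theorem coprimeMatchable_of_searchBlocks : ∀ depth x y g : ℕ, searchBlocks depth x y g = true →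
    CoprimeMatchable (Set.Ioc x (x + g)) (Set.Ioc y (y + g))
  | 0, x, y, g, h => by
    obtain rfl := Nat.eq_of_beq_eq_true h
    exact coprimeMatchable_of_fastReflectCoprime 0 x y (by simp [fastReflectCoprime, reflectCoprime])
  | depth + 1, x, y, g, h => by
    rw [searchBlocks, Bool.or_eq_true] at h
    rcases h with h | h
    · obtain rfl := Nat.eq_of_beq_eq_true h
      exact coprimeMatchable_of_fastReflectCoprime 0 x y (by simp [fastReflectCoprime, reflectCoprime])
    · exact coprimeMatchable_of_searchCut _ x y g
        (fun i hi => coprimeMatchable_of_searchBlocks depth x y i hi) g le_rfl h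

/-- The pairs `(l, k)` that are not settled by three reflected blocks. -/
def isExceptional (l k : ℕ) : Bool :=
  (k.beq 8 && l.beq 2) || (k.beq 14 && l.beq 8) || (k.beq 15 && l.beq 7)

/-- Test all `l < n` for a given `k`. -/
def checkRow (k : ℕ) : ℕ → Bool
  | 0 => true
  | l + 1 => (isExceptional l k || searchBlocks 3 l (l + k) k) && checkRow k l

/-- Test all `l < k` for `4 ≤ k < n + 4`. -/
def checkTable : ℕ → Bool
  | 0 => true
  | n + 1 => checkRow (n + 4) (n + 4) && checkTable n

theorem checkTable_eq_true : checkTable 110 = true := by decide +kernel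

theorem coprimeMatchable_of_finset (f : ℕ → ℕ) (s t : Finset ℕ) (h1 : ∀ a ∈ s, f a ∈ t)
    (h2 : ∀ b ∈ t, ∃ a ∈ s, f a = b) (h3 : s.card ≤ t.card) (h4 : ∀ a ∈ s, Nat.gcd a (f a) = 1) :
    CoprimeMatchable (s : Set ℕ) (t : Set ℕ) :=
  ⟨f, ⟨fun a ha => h1 a ha,
    Finset.injOn_of_surjOn_of_card_le f (fun a ha => h1 a ha) (fun b hb => h2 b hb) h3,
    fun b hb => h2 b hb⟩, h4⟩

theorem coprimeMatchable_of_isExceptional (l k : ℕ) (h : isExceptional l k = true) :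
    CoprimeMatchable (Set.Ioc l (l + k)) (Set.Ioc (l + k) (l + k + k)) := by
  have key : (k = 8 ∧ l = 2 ∨ k = 14 ∧ l = 8) ∨ k = 15 ∧ l = 7 := by
    simpa [isExceptional] using h
  rw [← Finset.coe_Ioc, ← Finset.coe_Ioc]
  rcases key with (⟨rfl, rfl⟩ | ⟨rfl, rfl⟩) | ⟨rfl, rfl⟩
  · exact coprimeMatchable_of_finset
      -- The list starts with the image of `l + 1`; the default 0 is never reached.
      (fun a => [16, 15, 18, 17, 12, 13, 14, 11].getD (a - 3) 0)
      _ _ (by decide) (by decide) (by decide) (by decide)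
  · exact coprimeMatchable_of_finset
      (fun a => [34, 33, 28, 35, 36, 31, 32, 25, 30, 29, 24, 27, 26, 23].getD (a - 9) 0)
      _ _ (by decide) (by decide) (by decide) (by decide)
  · exact coprimeMatchable_of_finset
      (fun a => [35, 34, 33, 28, 37, 36, 31, 32, 25, 30, 29, 24, 27, 26, 23].getD (a - 8) 0)
      _ _ (by decide) (by decide) (by decide) (by decide)

theorem coprimeMatchable_of_checkRow (k : ℕ) : ∀ n, checkRow k n = true → ∀ l < n,
    CoprimeMatchable (Set.Ioc l (l + k)) (Set.Ioc (l + k) (l + k + k))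
  | 0, _, _, hl => absurd hl (Nat.not_lt_zero _)
  | n + 1, h, l, hl => by
    rw [checkRow, Bool.and_eq_true, Bool.or_eq_true] at h
    rcases Nat.lt_succ_iff_lt_or_eq.1 hl with hl | rfl
    · exact coprimeMatchable_of_checkRow k n h.2 l hl
    · rcases h.1 with h | h
      · exact coprimeMatchable_of_isExceptional l k h
      · exact coprimeMatchable_of_searchBlocks 3 l (l + k) k h

theorem coprimeMatchable_of_checkTable : ∀ n, checkTable n = true → ∀ k l, 4 ≤ k → k < n + 4 →
    l < k → CoprimeMatchable (Set.Ioc l (l + k)) (Set.Ioc (l + k) (l + k + k))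
  | 0, _, k, l, h4, hk, hl => by omega
  | n + 1, h, k, l, h4, hk, hl => by
    rw [checkTable, Bool.and_eq_true] at h
    rcases Nat.lt_or_ge k (n + 4) with hk' | hk'
    · exact coprimeMatchable_of_checkTable n h.2 k l h4 hk' hl
    · obtain rfl : k = n + 4 := by omega
      exact coprimeMatchable_of_checkRow _ _ h.1 l hl

/-! ### Sieving a progression of step 2 by odd primes -/

open Finset

/-- The odd primes dividing `n`. -/
def oddPrimeFactors (n : ℕ) : Finset ℕ := n.primeFactors.erase 2

theorem mem_oddPrimeFactors {n p : ℕ} (hn : n ≠ 0) :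
    p ∈ oddPrimeFactors n ↔ p.Prime ∧ p ≠ 2 ∧ p ∣ n := by
  rw [oddPrimeFactors, mem_erase, Nat.mem_primeFactors]
  tauto

/-- A finite set consisting of odd primes. -/
def AreOddPrimes (P : Finset ℕ) : Prop := ∀ p ∈ P, p.Prime ∧ p ≠ 2

theorem AreOddPrimes.mono {P Q : Finset ℕ} (hP : AreOddPrimes P) (h : Q ⊆ P) : AreOddPrimes Q :=
  fun p hp => hP p (h hp)

theorem areOddPrimes_oddPrimeFactors (n : ℕ) : AreOddPrimes (oddPrimeFactors n) := fun _ hp =>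
  ⟨Nat.prime_of_mem_primeFactors (mem_of_mem_erase hp), ne_of_mem_erase hp⟩

theorem AreOddPrimes.three_le {P : Finset ℕ} (hP : AreOddPrimes P) {p : ℕ} (hp : p ∈ P) :
    3 ≤ p := by
  have := (hP p hp).1.two_le
  have := (hP p hp).2
  omega

theorem AreOddPrimes.prod_dvd_iff {P : Finset ℕ} (hP : AreOddPrimes P) (n : ℕ) :
    ∏ p ∈ P, p ∣ n ↔ ∀ p ∈ P, p ∣ n :=
  ⟨fun h _ hp => (dvd_prod_of_mem _ hp).trans h,
    prod_primes_dvd n fun p hp => (hP p hp).1.prime⟩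

theorem AreOddPrimes.odd_prod {P : Finset ℕ} (hP : AreOddPrimes P) : Odd (∏ p ∈ P, p) :=
  prod_induction _ Odd (fun _ _ => Odd.mul) odd_one
    fun p hp => (hP p hp).1.odd_of_ne_two (hP p hp).2

theorem prod_oddPrimeFactors_le {n : ℕ} (hn : n ≠ 0) : ∏ p ∈ oddPrimeFactors n, p ≤ n :=
  Nat.le_of_dvd (Nat.pos_of_ne_zero hn) (((areOddPrimes_oddPrimeFactors n).prod_dvd_iff n).2
    fun _ hp => Nat.dvd_of_mem_primeFactors (mem_of_mem_erase hp))

/-- The number of multiples of an odd `d` among `a, a + 2, …, a + 2 (m - 1)`. -/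
theorem abs_card_dvd_sub_le {d : ℕ} (hd : Odd d) (a m : ℕ) :
    |(#{i ∈ range m | d ∣ a + 2 * i} : ℝ) - m / d| ≤ 1 := by
  have hd0 : 0 < d := hd.pos
  obtain ⟨e, he⟩ := hd
  -- With `d = 2 * e + 1` one has `2 * e ≡ -1`, so `d ∣ a + 2 * i` means `i ≡ e * a` modulo `d`.
  have hcount : #{i ∈ range m | d ∣ a + 2 * i} =
      m / d + if (e * a) % d < m % d then 1 else 0 := by
    rw [← Nat.count_modEq_card m hd0, Nat.count_eq_card_filter_range]
    congr 1
    refine filter_congr fun i _ => ?_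
    rw [Nat.modEq_iff_dvd, ← Int.natCast_dvd_natCast]
    subst he
    push_cast
    constructor
    · rintro ⟨c, hc⟩
      exact ⟨e * c - i, by linear_combination (e : ℤ) * hc⟩
    · rintro ⟨c, hc⟩
      exact ⟨a - 2 * c, by linear_combination (-2 : ℤ) * hc⟩
  have hm : (m : ℝ) = d * (m / d : ℕ) + (m % d : ℕ) := by exact_mod_cast (Nat.div_add_mod m d).symm
  have hd' : (0 : ℝ) < d := by exact_mod_cast hd0
  have hlt : ((m % d : ℕ) : ℝ) < d := by exact_mod_cast Nat.mod_lt m hd0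
  have hdiv : (m : ℝ) / d = (m / d : ℕ) + (m % d : ℕ) / (d : ℝ) := by
    nth_rewrite 1 [hm]
    field_simp
  have h0 : 0 ≤ ((m % d : ℕ) : ℝ) / d := by positivity
  have h1 : ((m % d : ℕ) : ℝ) / d ≤ 1 := (div_le_one hd').2 hlt.le
  rw [hcount, hdiv, abs_le]
  split_ifs <;> push_cast <;> constructor <;> linarith

/-- The number of terms among `a, a + 2, …, a + 2 (m - 1)` that no element of `P` divides. -/
def siftedCard (P : Finset ℕ) (a m : ℕ) : ℕ := #{i ∈ range m | ∀ p ∈ P, ¬ p ∣ a + 2 * i}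

/-- Used with `w = -1` for the sieve and with `w p = 1 / |p - 1|` for the mean of `r`. -/
theorem sum_prod_one_add_ite_dvd {P : Finset ℕ} (hP : AreOddPrimes P) (w : ℕ → ℝ) (a m : ℕ) :
    ∑ i ∈ range m, ∏ p ∈ P, (1 + w p * if p ∣ a + 2 * i then 1 else 0) =
      ∑ Q ∈ P.powerset, (∏ p ∈ Q, w p) * #{i ∈ range m | ∏ p ∈ Q, p ∣ a + 2 * i} := by
  simp_rw [prod_one_add]
  rw [sum_comm]
  refine sum_congr rfl fun Q hQ => ?_
  rw [card_filter, Nat.cast_sum, mul_sum]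
  refine sum_congr rfl fun i _ => ?_
  rw [prod_mul_distrib, prod_ite_zero]
  simp only [(hP.mono (mem_powerset.1 hQ)).prod_dvd_iff, prod_const_one]
  push_cast
  rfl

/-- Legendre's inclusion-exclusion: each nonempty `Q ⊆ P` costs an error of at most 1, and the empty
set costs none. -/
theorem siftedCard_ge {P : Finset ℕ} (hP : AreOddPrimes P) (a m : ℕ) :
    m * ∏ p ∈ P, (1 - 1 / (p : ℝ)) - (2 ^ #P - 1) ≤ siftedCard P a m := by
  have hsift : (siftedCard P a m : ℝ) =
      ∑ Q ∈ P.powerset, (∏ p ∈ Q, (-1 : ℝ)) * #{i ∈ range m | ∏ p ∈ Q, p ∣ a + 2 * i} := by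
    rw [← sum_prod_one_add_ite_dvd hP, siftedCard, card_filter, Nat.cast_sum]
    refine sum_congr rfl fun i _ => ?_
    have h := prod_ite_zero (s := P) (p := fun p => ¬ p ∣ a + 2 * i) (f := fun _ => (1 : ℝ))
    rw [prod_const_one] at h
    push_cast
    rw [← h]
    refine prod_congr rfl fun p _ => ?_
    split_ifs <;> simp_all
  have hmain : (m : ℝ) * ∏ p ∈ P, (1 - 1 / (p : ℝ)) =
      ∑ Q ∈ P.powerset, (∏ p ∈ Q, (-1 : ℝ)) * (m / (∏ p ∈ Q, p : ℕ)) := by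
    simp_rw [sub_eq_add_neg]
    rw [prod_one_add, mul_sum]
    refine sum_congr rfl fun Q _ => ?_
    simp_rw [neg_eq_neg_one_mul (1 / (_ : ℝ))]
    rw [prod_mul_distrib]
    simp only [one_div, prod_inv_distrib]
    push_cast
    ring
  have hdiff : (m : ℝ) * ∏ p ∈ P, (1 - 1 / (p : ℝ)) - siftedCard P a m ≤
      ∑ Q ∈ P.powerset.erase ∅, 1 := by
    rw [hsift, hmain, ← sum_sub_distrib, ← sum_erase_add _ _ (empty_mem_powerset P)]
    simp only [prod_empty, one_dvd, filter_true, card_range, Nat.cast_one,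
      div_one, sub_self, add_zero]
    refine sum_le_sum fun Q hQ => ?_
    rw [← mul_sub]
    refine (le_abs_self _).trans ?_
    rw [abs_mul, abs_prod, abs_neg, abs_one, prod_const_one, one_mul, abs_sub_comm]
    exact abs_card_dvd_sub_le
      (hP.mono (mem_powerset.1 (mem_of_mem_erase hQ))).odd_prod a m
  rw [sum_const, nsmul_eq_mul, mul_one, card_erase_of_mem (empty_mem_powerset P),
    card_powerset, Nat.cast_sub Nat.one_le_two_pow] at hdiff
  push_cast at hdiff
  linarith

/-! ### The range `m < 40000`: at most five odd primes -/

/-- Among all sets of `k` odd primes, `A` bounds `∏ (1 - 1 / p)` and `B` bounds `∏ p` from below. -/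
def IsOddPrimeBound (k : ℕ) (A : ℝ) (B : ℕ) : Prop :=
  ∀ P : Finset ℕ, AreOddPrimes P → #P = k →
    A ≤ ∏ p ∈ P, (1 - 1 / (p : ℝ)) ∧ B ≤ ∏ p ∈ P, p

theorem isOddPrimeBound_zero : IsOddPrimeBound 0 1 1 := fun P _ hP => by
  rw [card_eq_zero] at hP
  simp [hP]

theorem IsOddPrimeBound.succ {k B : ℕ} {A : ℝ} (h : IsOddPrimeBound k A B) (hA : 0 ≤ A) (c : ℕ)
    (hc0 : 1 ≤ c) (hc : #{p ∈ range c | p.Prime ∧ p ≠ 2} ≤ k) :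
    IsOddPrimeBound (k + 1) (A * (1 - 1 / (c : ℝ))) (B * c) := by
  intro P hP hcard
  -- Fewer than `k + 1` odd primes lie below `c`, so some member is at least `c`; it is split off.
  obtain ⟨q, hq, hcq⟩ : ∃ q ∈ P, c ≤ q := by
    by_contra! hlt
    have : P ⊆ {p ∈ range c | p.Prime ∧ p ≠ 2} := fun p hp =>
      mem_filter.2 ⟨mem_range.2 (hlt p hp), hP p hp⟩
    have := card_le_card this
    omega
  obtain ⟨h1, h2⟩ := h (P.erase q) (hP.mono (erase_subset _ _))
    (by rw [card_erase_of_mem hq, hcard, Nat.add_sub_cancel])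
  rw [← prod_erase_mul _ _ hq, ← prod_erase_mul _ (fun p => p) hq]
  have hc1 : (1 : ℝ) ≤ c := by exact_mod_cast hc0
  have hcq' : (c : ℝ) ≤ q := by exact_mod_cast hcq
  have hle : 1 - 1 / (c : ℝ) ≤ 1 - 1 / (q : ℝ) :=
    sub_le_sub_left (one_div_le_one_div_of_le (by linarith) hcq') _
  have hnn : 0 ≤ 1 - 1 / (c : ℝ) := by
    have : 1 / (c : ℝ) ≤ 1 := (div_le_one (by linarith)).2 hc1
    linarith
  exact ⟨mul_le_mul h1 hle hnn (hA.trans h1), Nat.mul_le_mul h2 hcq⟩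

theorem isOddPrimeBound_one : IsOddPrimeBound 1 (2 / 3) 3 := by
  have := isOddPrimeBound_zero.succ (by norm_num) 3 (by norm_num) (by decide)
  norm_num at this; exact this

theorem isOddPrimeBound_two : IsOddPrimeBound 2 (8 / 15) 15 := by
  have := isOddPrimeBound_one.succ (by norm_num) 5 (by norm_num) (by decide)
  norm_num at this; exact this

theorem isOddPrimeBound_three : IsOddPrimeBound 3 (16 / 35) 105 := by
  have := isOddPrimeBound_two.succ (by norm_num) 7 (by norm_num) (by decide)
  norm_num at this; exact this

theorem isOddPrimeBound_four : IsOddPrimeBound 4 (32 / 77) 1155 := by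
  have := isOddPrimeBound_three.succ (by norm_num) 11 (by norm_num) (by decide)
  norm_num at this; exact this

theorem isOddPrimeBound_five : IsOddPrimeBound 5 (384 / 1001) 15015 := by
  have := isOddPrimeBound_four.succ (by norm_num) 13 (by norm_num) (by decide)
  norm_num at this; exact this

theorem isOddPrimeBound_six : IsOddPrimeBound 6 (6144 / 17017) 255255 := by
  have := isOddPrimeBound_five.succ (by norm_num) 17 (by norm_num) (by decide)
  norm_num at this; exact this

theorem AreOddPrimes.card_le_five {P : Finset ℕ} (hP : AreOddPrimes P)
    (hlt : ∏ p ∈ P, p < 255255) : #P ≤ 5 := by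
  by_contra! h
  obtain ⟨Q, hQP, hQ⟩ := exists_subset_card_eq (Nat.succ_le_of_lt h)
  have h1 := (isOddPrimeBound_six Q (hP.mono hQP) hQ).2
  have h2 : ∏ p ∈ Q, p ≤ ∏ p ∈ P, p := prod_le_prod_of_subset_of_one_le' hQP
    fun p hp _ => (hP p hp).1.one_lt.le
  omega

/-- The case of three primes forces `57 ≤ m`: `16 / 35 * m - 7 > m / 3`. With four or five primes,
the size of their product makes `m` large enough. -/
theorem third_lt_siftedCard {P : Finset ℕ} (hP : AreOddPrimes P) {m : ℕ} (hm : 57 ≤ m)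
    (hm' : m < 40000) (hle : ∏ p ∈ P, p ≤ 6 * m + 2) (b : ℕ) :
    (m : ℝ) / 3 < siftedCard P b m := by
  have h := siftedCard_ge hP b m
  have hcard := hP.card_le_five (by omega)
  have hm0 : (57 : ℝ) ≤ m := by exact_mod_cast hm
  have key : ∀ {A : ℝ} {B : ℕ}, IsOddPrimeBound (#P) A B →
      m * A ≤ m * ∏ p ∈ P, (1 - 1 / (p : ℝ)) ∧ (B : ℝ) ≤ 6 * m + 2 := fun hb =>
    ⟨mul_le_mul_of_nonneg_left (hb P hP rfl).1 (by linarith),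
      by exact_mod_cast (hb P hP rfl).2.trans hle⟩
  generalize #P = k at h hcard key
  interval_cases k
  · have := key isOddPrimeBound_zero; linarith
  · have := key isOddPrimeBound_one; linarith
  · have := key isOddPrimeBound_two; linarith
  · have := key isOddPrimeBound_three; linarith
  · have := key isOddPrimeBound_four; push_cast at this; linarith
  · have := key isOddPrimeBound_five; push_cast at this; linarith

/-- Adjoining 3 to `P` allows the bounds for `#P + 1` primes; dividing out `1 - 1 / 3` gives the
factor `3 / 2`. -/
theorem half_le_siftedCard {P : Finset ℕ} (hP : AreOddPrimes P) (h3 : 3 ∉ P) {m : ℕ} (hm : 57 ≤ m)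
    (hm' : m < 40000) (hle : ∏ p ∈ P, p ≤ 6 * m + 2) (b : ℕ) :
    (m : ℝ) / 2 ≤ siftedCard P b m := by
  have h := siftedCard_ge hP b m
  have hcard := hP.card_le_five (by omega)
  have hm0 : (57 : ℝ) ≤ m := by exact_mod_cast hm
  have hP' : AreOddPrimes (insert 3 P) := fun p hp => by
    rcases mem_insert.1 hp with rfl | hp
    · norm_num
    · exact hP p hp
  have key : ∀ {A : ℝ} {B : ℕ}, IsOddPrimeBound (#P + 1) A B →
      m * (3 / 2 * A) ≤ m * ∏ p ∈ P, (1 - 1 / (p : ℝ)) ∧ (B : ℝ) ≤ 3 * (6 * m + 2) := by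
    intro A B hb
    obtain ⟨h1, h2⟩ := hb _ hP' (card_insert_of_notMem h3)
    rw [prod_insert h3] at h1 h2
    refine ⟨mul_le_mul_of_nonneg_left ?_ (by linarith), ?_⟩
    · norm_num at h1 ⊢; linarith
    · exact_mod_cast h2.trans (Nat.mul_le_mul_left 3 hle)
  generalize #P = k at h hcard key
  interval_cases k
  · have := key isOddPrimeBound_one; linarith
  · have := key isOddPrimeBound_two; linarith
  · have := key isOddPrimeBound_three; linarith
  · have := key isOddPrimeBound_four; linarith
  · have := key isOddPrimeBound_five; push_cast at this; linarith
  · have := key isOddPrimeBound_six; push_cast at this; linarith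

theorem not_siftedCard_le_of_lt {a b m D : ℕ} (hm : 57 ≤ m) (hm' : m < 40000) (ha : a ≠ 0)
    (han : ∀ i < m, a + 2 * i ≤ 6 * m + 2) {S : Finset ℕ} (hS : S ⊆ range m) (hDS : D < #S)
    (hDm : 2 * D < m) (hdeg : ∀ i ∈ S, siftedCard (oddPrimeFactors (a + 2 * i)) b m ≤ D) :
    False := by
  have hle : ∀ i ∈ S, ∏ p ∈ oddPrimeFactors (a + 2 * i), p ≤ 6 * m + 2 := fun i hi =>
    (prod_oddPrimeFactors_le (by omega)).trans (han i (mem_range.1 (hS hi)))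
  have hsub : S ⊆ {i ∈ range m | 3 ∣ a + 2 * i} := by
    intro i hi
    refine mem_filter.2 ⟨hS hi, ?_⟩
    by_contra h3
    have h1 := half_le_siftedCard (areOddPrimes_oddPrimeFactors (a + 2 * i))
      (fun h => h3 ((mem_oddPrimeFactors (by omega)).1 h).2.2) hm hm' (hle i hi) b
    have h2 : (siftedCard (oddPrimeFactors (a + 2 * i)) b m : ℝ) ≤ D := by
      exact_mod_cast hdeg i hi
    have h3 : 2 * (D : ℝ) < m := by exact_mod_cast hDm
    linarith
  obtain ⟨i, hi⟩ : S.Nonempty := card_pos.1 (by omega)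
  have h1 := third_lt_siftedCard (areOddPrimes_oddPrimeFactors (a + 2 * i)) hm hm' (hle i hi) b
  have h2 : (siftedCard (oddPrimeFactors (a + 2 * i)) b m : ℝ) ≤ D := by
    exact_mod_cast hdeg i hi
  have h3 : (D : ℝ) + 1 ≤ #{i ∈ range m | 3 ∣ a + 2 * i} := by
    exact_mod_cast hDS.trans_le (card_le_card hsub)
  have h4 := (abs_le.1 (abs_card_dvd_sub_le (d := 3) (by decide) a m)).2
  push_cast at h4
  linarith

/-! ### Large `m`: averaging `r` -/

/-- The term subtracted from `7 / 5` makes the induction close; the base case needs three factors.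
-/
theorem prod_one_add_inv_le (N : ℕ) :
    ∏ j ∈ range (N + 3), (1 + 1 / ((2 * j + 2 : ℝ) * (2 * j + 3))) ≤
      7 / 5 - 2 / 5 / ((N : ℝ) + 3) := by
  induction N with
  | zero => norm_num [prod_range_succ]
  | succ N ih =>
    rw [Nat.add_right_comm, prod_range_succ]
    refine (mul_le_mul_of_nonneg_right ih (by positivity)).trans ?_
    push_cast
    rw [← sub_nonneg]
    have : 7 / 5 - 2 / 5 / ((N : ℝ) + 1 + 3) - (7 / 5 - 2 / 5 / ((N : ℝ) + 3)) *
        (1 + 1 / ((2 * (N + 3 : ℝ) + 2) * (2 * (N + 3 : ℝ) + 3))) =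
        (N + 17) / (5 * (N + 3) * (2 * (N + 3) + 2) * (2 * (N + 3) + 3)) := by
      field_simp
      ring
    rw [this]
    positivity

/-- The induction step is `(2N + 1)(2N + 3) ≤ (2N + 2)²`. -/
theorem prod_one_add_inv_le_sqrt (N : ℕ) :
    ∏ j ∈ range N, (1 + 1 / (2 * j + 2 : ℝ)) ≤ √(2 * N + 1) := by
  induction N with
  | zero => simp
  | succ N ih =>
    rw [prod_range_succ]
    refine (mul_le_mul_of_nonneg_right ih (by positivity)).trans ?_
    refine Real.le_sqrt_of_sq_le ?_
    rw [mul_pow, Real.sq_sqrt (by positivity)]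
    push_cast
    rw [← sub_nonneg]
    have : 2 * ((N : ℝ) + 1) + 1 - (2 * N + 1) * (1 + 1 / (2 * N + 2)) ^ 2 =
        (2 * N + 3) / (2 * N + 2) ^ 2 := by
      field_simp
      ring
    rw [this]
    positivity

theorem prod_le_prod_range_odd {P : Finset ℕ} (hP : AreOddPrimes P) {N : ℕ}
    (hN : ∀ p ∈ P, p ≤ 2 * N + 2) (w : ℕ → ℝ) (hw : ∀ j, 1 ≤ w j) :
    ∏ p ∈ P, w p ≤ ∏ j ∈ range N, w (2 * j + 3) := by
  rw [← prod_image (s := range N) (g := fun j => 2 * j + 3) (f := w)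
    (fun x _ y _ h => by simpa using h)]
  refine prod_le_prod_of_subset_of_one_le (fun p hp => ?_)
    (fun p _ => zero_le_one.trans (hw p)) fun p _ _ => hw p
  have h3 := hP.three_le hp
  have hn := hN p hp
  obtain ⟨c, hc⟩ := (hP p hp).1.odd_of_ne_two (hP p hp).2
  exact mem_image.2 ⟨c - 1, mem_range.2 (by omega), by omega⟩

/-- An upper bound for the sum of `n / φ(n)` over `n = a + 2 i`, restricted to odd primes. -/
theorem sum_prod_one_add_le {a m N : ℕ} (ha : a ≠ 0) (hN3 : 3 ≤ N)
    (hN : ∀ i < m, a + 2 * i ≤ 2 * N + 2) :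
    ∑ i ∈ range m, ∏ p ∈ oddPrimeFactors (a + 2 * i), (1 + 1 / ((p : ℝ) - 1)) ≤
      7 / 5 * m + √(2 * N + 1) := by
  set P : Finset ℕ := {p ∈ range (2 * N + 3) | p.Prime ∧ p ≠ 2} with hPdef
  have hP : AreOddPrimes P := fun p hp => (mem_filter.1 hp).2
  have hPN : ∀ p ∈ P, p ≤ 2 * N + 2 := fun p hp =>
    Nat.lt_succ_iff.1 (mem_range.1 (mem_filter.1 hp).1)
  -- The absolute value matters only at `p = 0`, where it keeps the weight nonnegative.
  have hw0 : ∀ p : ℕ, 0 ≤ 1 / |(p : ℝ) - 1| := fun p => by positivity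
  have habs : ∀ Q ⊆ P, ∀ p ∈ Q, |(p : ℝ) - 1| = p - 1 := fun Q hQ p hp => by
    have : (3 : ℝ) ≤ p := by exact_mod_cast hP.three_le (hQ hp)
    exact abs_of_nonneg (by linarith)
  have h1 : ∀ i ∈ range m, ∏ p ∈ oddPrimeFactors (a + 2 * i), (1 + 1 / ((p : ℝ) - 1)) =
      ∏ p ∈ P, (1 + 1 / |(p : ℝ) - 1| * if p ∣ a + 2 * i then 1 else 0) := by
    intro i hi
    have hfac : oddPrimeFactors (a + 2 * i) = {p ∈ P | p ∣ a + 2 * i} := by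
      ext p
      rw [mem_oddPrimeFactors (by omega), mem_filter, hPdef, mem_filter, mem_range]
      have hb := hN i (mem_range.1 hi)
      constructor
      · rintro ⟨h1, h2, h3⟩
        have := Nat.le_of_dvd (by omega) h3
        exact ⟨⟨by omega, h1, h2⟩, h3⟩
      · rintro ⟨⟨-, h1, h2⟩, h3⟩
        exact ⟨h1, h2, h3⟩
    rw [hfac, prod_filter]
    refine prod_congr rfl fun p hp => ?_
    rw [habs P subset_rfl p hp]
    split_ifs <;> simp
  rw [sum_congr rfl h1, sum_prod_one_add_ite_dvd hP]
  have h2 : ∀ Q ∈ P.powerset, (∏ p ∈ Q, 1 / |(p : ℝ) - 1|) *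
      #{i ∈ range m | ∏ p ∈ Q, p ∣ a + 2 * i} ≤
      m * (∏ p ∈ Q, 1 / |(p : ℝ) - 1| * (1 / p)) + ∏ p ∈ Q, 1 / |(p : ℝ) - 1| := by
    intro Q hQ
    have h3 := (abs_le.1 (abs_card_dvd_sub_le
      (hP.mono (mem_powerset.1 hQ)).odd_prod a m)).2
    have h4 : 0 ≤ ∏ p ∈ Q, 1 / |(p : ℝ) - 1| := prod_nonneg fun p _ => hw0 p
    have h5 : (∏ p ∈ Q, 1 / (p : ℝ)) = 1 / (∏ p ∈ Q, p : ℕ) := by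
      push_cast
      simp
    rw [prod_mul_distrib, h5]
    calc _ ≤ (∏ p ∈ Q, 1 / |(p : ℝ) - 1|) * (m / (∏ p ∈ Q, p : ℕ) + 1) :=
          mul_le_mul_of_nonneg_left (by linarith) h4
      _ = _ := by ring
  refine (sum_le_sum h2).trans ?_
  rw [sum_add_distrib, ← mul_sum, ← prod_one_add, ← prod_one_add]
  have habs' : ∀ j : ℕ, |((2 * j + 3 : ℕ) : ℝ) - 1| = 2 * j + 2 := fun j => by
    push_cast
    rw [abs_of_nonneg (by linarith [(Nat.cast_nonneg j : (0 : ℝ) ≤ j)])]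
    ring
  have h6 : ∏ p ∈ P, (1 + 1 / |(p : ℝ) - 1| * (1 / p)) ≤ 7 / 5 := by
    refine (prod_le_prod_range_odd hP hPN (fun p => 1 + 1 / |(p : ℝ) - 1| * (1 / p))
      fun p => le_add_of_nonneg_right (by positivity)).trans ?_
    obtain ⟨M, rfl⟩ := Nat.exists_eq_add_of_le' hN3
    have h7 : (0 : ℝ) ≤ 2 / 5 / ((M : ℝ) + 3) := by positivity
    refine le_trans (le_of_eq (prod_congr rfl fun j _ => ?_))
      ((prod_one_add_inv_le M).trans (by linarith))
    rw [habs', one_div_mul_one_div]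
    push_cast
    rfl
  have h8 : ∏ p ∈ P, (1 + 1 / |(p : ℝ) - 1|) ≤ √(2 * N + 1) := by
    refine (prod_le_prod_range_odd hP hPN (fun p => 1 + 1 / |(p : ℝ) - 1|)
      fun p => le_add_of_nonneg_right (hw0 p)).trans ?_
    refine le_trans (le_of_eq (prod_congr rfl fun j _ => ?_)) (prod_one_add_inv_le_sqrt N)
    rw [habs']
  linarith [mul_le_mul_of_nonneg_left h6 (Nat.cast_nonneg m : (0 : ℝ) ≤ m)]

/-- Controls the sieve error multiplied by `r`. Prime by prime, `(2p / (p - 1))² ≤ p` for `p ≥ 7`,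
while 3 and 5 lose factors `3` and `5 / 4`, together below 4. -/
theorem two_pow_card_mul_prod_le {P : Finset ℕ} (hP : AreOddPrimes P) :
    2 ^ #P * ∏ p ∈ P, (1 + 1 / ((p : ℝ) - 1)) ≤ 2 * √(∏ p ∈ P, p : ℕ) := by
  have hp3 : ∀ p ∈ P, (3 : ℝ) ≤ p := fun p hp => by exact_mod_cast hP.three_le hp
  set c : ℕ → ℝ := fun p => if p = 3 then 3 else if p = 5 then 5 / 4 else 1 with hc
  have hc1 : ∀ p, 1 ≤ c p := fun p => by
    simp only [hc]; split_ifs <;> norm_num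
  have h1 : ∀ p ∈ P, (2 * (1 + 1 / ((p : ℝ) - 1))) ^ 2 ≤ c p * p := by
    intro p hp
    simp only [hc]
    split_ifs with h3 h5
    · subst h3; norm_num
    · subst h5; norm_num
    · have h7 : 7 ≤ p := by
        have h1 := hP.three_le hp
        have h2 : p ≠ 4 := fun h => by have := (hP p hp).1; subst h; revert this; norm_num
        have h4 : p ≠ 6 := fun h => by have := (hP p hp).1; subst h; revert this; norm_num
        omega
      have h7' : (7 : ℝ) ≤ p := by exact_mod_cast h7
      have hpos : (0 : ℝ) < p - 1 := by linarith
      rw [show 2 * (1 + 1 / ((p : ℝ) - 1)) = 2 * p / (p - 1) by field_simp; ring, div_pow,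
        div_le_iff₀ (by positivity)]
      nlinarith
  have h2 : ∏ p ∈ P, c p ≤ 4 := by
    have h3 : ∏ p ∈ P, c p ≤ ∏ p ∈ P ∪ {3, 5}, c p :=
      prod_le_prod_of_subset_of_one_le subset_union_left
        (fun p _ => zero_le_one.trans (hc1 p)) fun p _ _ => hc1 p
    have h4 : ∏ p ∈ ({3, 5} : Finset ℕ), c p = ∏ p ∈ P ∪ {3, 5}, c p :=
      prod_subset subset_union_right fun p _ hp => by
        simp only [mem_insert, mem_singleton, not_or] at hp
        simp only [hc, if_neg hp.1, if_neg hp.2]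
    rw [← h4] at h3
    refine h3.trans ?_
    rw [prod_insert (by decide), prod_singleton]
    norm_num [hc]
  have h5 : (∏ p ∈ P, 2 * (1 + 1 / ((p : ℝ) - 1))) ^ 2 ≤ 4 * (∏ p ∈ P, p : ℕ) := by
    rw [← prod_pow]
    refine (prod_le_prod (fun p _ => sq_nonneg _) h1).trans ?_
    rw [prod_mul_distrib]
    push_cast
    exact mul_le_mul_of_nonneg_right h2 (prod_nonneg fun p _ => Nat.cast_nonneg p)
  rw [prod_mul_distrib, prod_const] at h5
  refine (Real.le_sqrt_of_sq_le h5).trans (le_of_eq ?_)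
  rw [Real.sqrt_mul (by norm_num), show (4 : ℝ) = 2 ^ 2 by norm_num, Real.sqrt_sq (by norm_num)]

theorem not_siftedCard_le_of_ge {a b m D : ℕ} (hm : 6000 ≤ m) (ha : a ≠ 0)
    (han : ∀ i < m, a + 2 * i ≤ 6 * m + 2) {S : Finset ℕ} (hS : S ⊆ range m) (hDS : D < #S)
    (hDm : 2 * D < m) (hdeg : ∀ i ∈ S, siftedCard (oddPrimeFactors (a + 2 * i)) b m ≤ D) :
    False := by
  set X : ℝ := √(2 * (3 * m + 1 : ℕ) + 1) with hX
  have hm0 : (6000 : ℝ) ≤ m := by exact_mod_cast hm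
  -- The final comparison is `m - 2X ≤ D + 2m/5 + X` with `D < m / 2`, which fails once `30X < m`.
  have hXm : 30 * X < m := by
    rw [hX, ← lt_div_iff₀' (by norm_num), Real.sqrt_lt' (by positivity)]
    push_cast
    nlinarith
  set r : ℕ → ℝ := fun i => ∏ p ∈ oddPrimeFactors (a + 2 * i), (1 + 1 / ((p : ℝ) - 1)) with hr
  have hinv : ∀ i, ∀ p ∈ oddPrimeFactors (a + 2 * i), 0 ≤ 1 / ((p : ℝ) - 1) := fun i p hp => by
    have : (3 : ℝ) ≤ p := by exact_mod_cast (areOddPrimes_oddPrimeFactors _).three_le hp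
    exact one_div_nonneg.2 (by linarith)
  have hr1 : ∀ i, 1 ≤ r i := fun i =>
    prod_induction _ (fun x : ℝ => 1 ≤ x) (fun _ _ => one_le_mul_of_one_le_of_one_le) le_rfl
      fun p hp => le_add_of_nonneg_right (hinv i p hp)
  have hsum : ∑ i ∈ range m, r i ≤ 7 / 5 * m + X :=
    sum_prod_one_add_le ha (by omega) fun i hi => (han i hi).trans (by omega)
  have hbig : ∀ i ∈ S, m - 2 * X ≤ D * r i := by
    intro i hi
    have hP := areOddPrimes_oddPrimeFactors (a + 2 * i)
    have h1 := siftedCard_ge hP b m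
    have h2 : (siftedCard (oddPrimeFactors (a + 2 * i)) b m : ℝ) ≤ D := by
      exact_mod_cast hdeg i hi
    have h3 := two_pow_card_mul_prod_le hP
    have h4 : √(∏ p ∈ oddPrimeFactors (a + 2 * i), p : ℕ) ≤ X := by
      refine Real.sqrt_le_sqrt ?_
      have := (prod_oddPrimeFactors_le (n := a + 2 * i) (by omega)).trans
        (han i (mem_range.1 (hS hi)))
      have h7 : ((∏ p ∈ oddPrimeFactors (a + 2 * i), p : ℕ) : ℝ) ≤ 6 * m + 2 := by
        exact_mod_cast this
      push_cast at h7 ⊢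
      linarith
    have h5 : (∏ p ∈ oddPrimeFactors (a + 2 * i), (1 - 1 / (p : ℝ))) * r i = 1 := by
      rw [hr, ← prod_mul_distrib]
      refine prod_eq_one fun p hp => ?_
      have : (3 : ℝ) ≤ p := by exact_mod_cast hP.three_le hp
      have h6 : (p : ℝ) - 1 ≠ 0 := by linarith
      field_simp
      ring
    have h6 := mul_le_mul_of_nonneg_right (h1.trans h2) (zero_le_one.trans (hr1 i))
    have h7 : (m : ℝ) * ((∏ p ∈ oddPrimeFactors (a + 2 * i), (1 - 1 / (p : ℝ))) * r i) = m := by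
      rw [h5, mul_one]
    have h8 := hr1 i
    nlinarith
  -- Subtracting 1 keeps the terms nonnegative, so the excess over `S` is at most the total excess
  -- `2m/5 + X`.
  have h1 : ∑ i ∈ S, (r i - 1) ≤ ∑ i ∈ range m, (r i - 1) :=
    sum_le_sum_of_subset_of_nonneg hS fun i _ _ => sub_nonneg.2 (hr1 i)
  rw [sum_sub_distrib, sum_sub_distrib, sum_const, sum_const, card_range, nsmul_eq_mul,
    nsmul_eq_mul, mul_one, mul_one] at h1
  have h2 := sum_le_sum hbig
  rw [sum_const, nsmul_eq_mul, ← mul_sum] at h2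
  have h3 : (D : ℝ) + 1 ≤ #S := by exact_mod_cast hDS
  have h4 : 2 * (D : ℝ) < m := by exact_mod_cast hDm
  have hD0 : (0 : ℝ) ≤ D := Nat.cast_nonneg D
  have hX0 : 0 ≤ X := Real.sqrt_nonneg _
  have h5 : (D : ℝ) * ∑ i ∈ S, r i ≤ D * (#S + (2 / 5 * m + X)) :=
    mul_le_mul_of_nonneg_left (by linarith) hD0
  have h6 : (D : ℝ) * (2 / 5 * m + X) ≤ #S * (2 / 5 * m + X) :=
    mul_le_mul_of_nonneg_right (by linarith) (by positivity)
  have h7 : (#S : ℝ) * (m - 2 * X) ≤ #S * (D + (2 / 5 * m + X)) := by linarith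
  have h8 := le_of_mul_le_mul_left h7 (by linarith)
  linarith

/-! ### Hall's condition and assembly -/

theorem not_siftedCard_le {a b m D : ℕ} (hm : 57 ≤ m) (ha : a ≠ 0)
    (han : ∀ i < m, a + 2 * i ≤ 6 * m + 2) {S : Finset ℕ} (hS : S ⊆ range m) (hDS : D < #S)
    (hDm : 2 * D < m) (hdeg : ∀ i ∈ S, siftedCard (oddPrimeFactors (a + 2 * i)) b m ≤ D) :
    False := by
  rcases Nat.lt_or_ge m 40000 with h | h
  · exact not_siftedCard_le_of_lt hm h ha han hS hDS hDm hdeg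
  · exact not_siftedCard_le_of_ge (by omega) ha han hS hDS hDm hdeg

/-- Hall's condition for the relation of having no common odd prime factor. -/
theorem card_le_card_biUnion {a b m : ℕ} (hm : 57 ≤ m) (ha : a ≠ 0) (hb : b ≠ 0)
    (han : ∀ i < m, a + 2 * i ≤ 6 * m + 2) (hbn : ∀ i < m, b + 2 * i ≤ 6 * m + 2)
    {S : Finset ℕ} (hS : S ⊆ range m) :
    #S ≤ #(S.biUnion fun i => {j ∈ range m | ∀ p ∈ oddPrimeFactors (a + 2 * i), ¬ p ∣ b + 2 * j}) := by
  by_contra! hlt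
  set N := S.biUnion fun i =>
    {j ∈ range m | ∀ p ∈ oddPrimeFactors (a + 2 * i), ¬ p ∣ b + 2 * j} with hN
  have hNm : N ⊆ range m := biUnion_subset.2 fun i _ => filter_subset _ _
  rcases Nat.lt_or_ge (2 * #N) m with h | h
  · exact not_siftedCard_le hm ha han hS hlt h fun i hi =>
      card_le_card (subset_biUnion_of_mem (fun i =>
        {j ∈ range m | ∀ p ∈ oddPrimeFactors (a + 2 * i), ¬ p ∣ b + 2 * j}) hi)
  · have hSm : #S ≤ m := by simpa using card_le_card hS
    have hT : #(range m \ N) = m - #N := by rw [card_sdiff_of_subset hNm, card_range]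
    have hS' : #(range m \ S) = m - #S := by rw [card_sdiff_of_subset hS, card_range]
    -- Exchange of sides: terms outside `N` have all their partners outside `S`, and `m - #S < m -
    -- #N`.
    refine not_siftedCard_le (a := b) (b := a) (D := m - #S) hm hb hbn (sdiff_subset (s := range m) (t := N))
      (by omega) (by omega) fun j hj => ?_
    rw [← hS', siftedCard]
    obtain ⟨hjm, hjN⟩ := mem_sdiff.1 hj
    refine card_le_card fun i hi => ?_
    obtain ⟨him, hi⟩ := mem_filter.1 hi
    refine mem_sdiff.2 ⟨him, fun hiS => hjN ?_⟩
    refine mem_biUnion.2 ⟨i, hiS, mem_filter.2 ⟨hjm, fun p hp hpj => ?_⟩⟩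
    obtain ⟨h1, h2, h3⟩ := (mem_oddPrimeFactors (by omega)).1 hp
    exact hi p ((mem_oddPrimeFactors (by omega)).2 ⟨h1, h2, hpj⟩) h3

theorem coprimeMatchable_of_arithProg {a b m : ℕ} (hm : 57 ≤ m) (ha : a ≠ 0) (hb : b ≠ 0)
    (hab : Odd (a + b))
    (han : ∀ i < m, a + 2 * i ≤ 6 * m + 2) (hbn : ∀ i < m, b + 2 * i ≤ 6 * m + 2) :
    CoprimeMatchable {x | ∃ i < m, x = a + 2 * i} {x | ∃ i < m, x = b + 2 * i} := by
  obtain ⟨f, hf, hfm⟩ := (all_card_le_biUnion_card_iff_exists_injective (fun i : Fin m =>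
    {j ∈ range m | ∀ p ∈ oddPrimeFactors (a + 2 * i), ¬ p ∣ b + 2 * j})).1 fun S => by
      have h := card_le_card_biUnion hm ha hb han hbn (S := S.map Fin.valEmbedding) fun i hi => by
        obtain ⟨j, -, rfl⟩ := mem_map.1 hi
        exact mem_range.2 j.2
      rw [card_map, map_eq_image, image_biUnion] at h
      exact h
  have hfm' : ∀ i, f i < m := fun i => mem_range.1 (mem_filter.1 (hfm i)).1
  have hsurj : ∀ j < m, ∃ i, f i = j := by
    have hinj : Function.Injective fun i : Fin m => (⟨f i, hfm' i⟩ : Fin m) := fun i j h =>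
      hf (Fin.mk.inj_iff.1 h)
    intro j hj
    obtain ⟨i, hi⟩ := Finite.surjective_of_injective hinj ⟨j, hj⟩
    exact ⟨i, Fin.mk.inj_iff.1 hi⟩
  let g : ℕ → ℕ := fun x => if h : (x - a) / 2 < m then b + 2 * f ⟨(x - a) / 2, h⟩ else 0
  have hg : ∀ i : Fin m, g (a + 2 * i) = b + 2 * f i := fun i => by
    have hi : (a + 2 * (i : ℕ) - a) / 2 = i := by omega
    simp only [g, hi, i.2, dite_true]
  refine ⟨g, ⟨?_, ?_, ?_⟩, ?_⟩
  · rintro _ ⟨i, hi, rfl⟩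
    exact ⟨f ⟨i, hi⟩, hfm' _, hg ⟨i, hi⟩⟩
  · rintro _ ⟨i, hi, rfl⟩ _ ⟨j, hj, rfl⟩ h
    rw [hg ⟨i, hi⟩, hg ⟨j, hj⟩] at h
    have := Fin.mk.inj_iff.1 (hf (by omega : f ⟨i, hi⟩ = f ⟨j, hj⟩))
    rw [this]
  · rintro _ ⟨j, hj, rfl⟩
    obtain ⟨i, rfl⟩ := hsurj j hj
    exact ⟨a + 2 * i, ⟨i, i.2, rfl⟩, hg i⟩
  · rintro _ ⟨i, hi, rfl⟩
    rw [hg ⟨i, hi⟩]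
    refine Nat.coprime_of_dvd fun p hp h1 h2 => ?_
    refine (mem_filter.1 (hfm ⟨i, hi⟩)).2 p ((mem_oddPrimeFactors (by omega)).2 ⟨hp, ?_, h1⟩) h2
    rintro rfl
    obtain ⟨c, hc⟩ := hab
    omega

theorem coprimeMatchable_adjacent {l k : ℕ} (hk : 4 ≤ k) (hl : l < k) :
    CoprimeMatchable (Set.Ioc l (l + k)) (Set.Ioc (l + k) (l + k + k)) := by
  rcases Nat.lt_or_ge k 114 with hk' | hk'
  -- From here `m ≥ 57`, and every entry is at most `l + 2k ≤ 3k - 1 ≤ 6m + 2` because `k ≤ 2m + 1`.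
  · exact coprimeMatchable_of_checkTable 110 checkTable_eq_true k l hk hk' hl
  rcases Nat.even_or_odd' k with ⟨m, rfl | rfl⟩
  · have h := (coprimeMatchable_of_arithProg (a := l + 1) (b := l + 2 * m + 2) (m := m)
      (by omega) (by omega) (by omega) ⟨l + m + 1, by ring⟩ (by omega) (by omega)).union
      (coprimeMatchable_of_arithProg (a := l + 2) (b := l + 2 * m + 1) (m := m)
      (by omega) (by omega) (by omega) ⟨l + m + 1, by ring⟩ (by omega) (by omega))
      (Set.disjoint_left.2 <| by rintro _ ⟨i, _, rfl⟩ ⟨j, _, h⟩; omega)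
      (Set.disjoint_left.2 <| by rintro _ ⟨i, _, rfl⟩ ⟨j, _, h⟩; omega)
    convert h using 1
    all_goals
      ext x
      simp only [Set.mem_Ioc, Set.mem_union, Set.mem_ofPred_eq]
      constructor
      · intro hx
        rcases Nat.even_or_odd' (x - l) with ⟨c, hc | hc⟩
        · first | exact Or.inr ⟨c - 1, by omega, by omega⟩ | exact Or.inl ⟨c - m - 1, by omega, by omega⟩
        · first | exact Or.inl ⟨c, by omega, by omega⟩ | exact Or.inr ⟨c - m, by omega, by omega⟩
      · rintro (⟨i, hi, rfl⟩ | ⟨i, hi, rfl⟩) <;> omega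
  · have h := (coprimeMatchable_of_arithProg (a := l + 1) (b := l + 2 * m + 2) (m := m + 1)
      (by omega) (by omega) (by omega) ⟨l + m + 1, by ring⟩ (by omega) (by omega)).union
      (coprimeMatchable_of_arithProg (a := l + 2) (b := l + 2 * m + 3) (m := m)
      (by omega) (by omega) (by omega) ⟨l + m + 2, by ring⟩ (by omega) (by omega))
      (Set.disjoint_left.2 <| by rintro _ ⟨i, _, rfl⟩ ⟨j, _, h⟩; omega)
      (Set.disjoint_left.2 <| by rintro _ ⟨i, _, rfl⟩ ⟨j, _, h⟩; omega)
    convert h using 1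
    all_goals
      ext x
      simp only [Set.mem_Ioc, Set.mem_union, Set.mem_ofPred_eq]
      constructor
      · intro hx
        rcases Nat.even_or_odd' (x - l) with ⟨c, hc | hc⟩
        · first | exact Or.inr ⟨c - 1, by omega, by omega⟩ | exact Or.inl ⟨c - m - 1, by omega, by omega⟩
        · first | exact Or.inl ⟨c, by omega, by omega⟩ | exact Or.inr ⟨c - m - 1, by omega, by omega⟩
      · rintro (⟨i, hi, rfl⟩ | ⟨i, hi, rfl⟩) <;> omega

theorem mainTheorem4 (l k : ℤ) (hl : 0 ≤ l) (hlk : l < k) (hk : 4 ≤ k) :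
    ∃ f : Set.Icc (l + 1) (l + k) → Set.Icc (l + k + 1) (l + 2 * k), IsCoprimeMapping f := by
  lift l to ℕ using hl
  lift k to ℕ using by omega
  obtain ⟨f, hf, hcop⟩ := coprimeMatchable_adjacent (l := l) (k := k) (by omega) (by omega)
  have hmem : ∀ a : Set.Icc ((l : ℤ) + 1) (l + k), (a : ℤ).toNat ∈ Set.Ioc l (l + k) := by
    rintro ⟨a, ha⟩
    simp only [Set.mem_Icc, Set.mem_Ioc] at ha ⊢
    omega
  refine ⟨fun a => ⟨f (a : ℤ).toNat, ?_⟩, ⟨fun a b hab => ?_, fun b => ?_⟩, fun a => ?_⟩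
  · have := hf.mapsTo (hmem a)
    simp only [Set.mem_Icc, Set.mem_Ioc] at this ⊢
    omega
  · have h1 : f (a : ℤ).toNat = f (b : ℤ).toNat := by exact_mod_cast Subtype.mk.inj hab
    have h2 := hf.injOn (hmem a) (hmem b) h1
    have h3 := a.2.1
    have h4 := b.2.1
    exact Subtype.ext (by omega)
  · obtain ⟨b, hb⟩ := b
    have hb' : b.toNat ∈ Set.Ioc (l + k) (l + k + k) := by
      simp only [Set.mem_Icc, Set.mem_Ioc] at hb ⊢
      omega
    obtain ⟨a, ha, hab⟩ := hf.surjOn hb'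
    refine ⟨⟨a, ?_⟩, Subtype.ext ?_⟩
    · simp only [Set.mem_Icc, Set.mem_Ioc] at ha ⊢
      omega
    · simp only [Int.toNat_natCast, hab]
      have := hb.1
      omega
  · have h1 := hcop _ (hmem a)
    have h2 : ((a : ℤ).toNat : ℤ) = a := Int.toNat_of_nonneg (by have := a.2.1; omega)
    have h3 := Nat.isCoprime_iff_coprime.2 h1
    rwa [h2] at h3
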